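/- Let $r,d\in\mathbb{N}=\{1,2,\dots\}$, $1\le p<\infty$, $Q=[0,1]^d$, $\bar p=\min(p,2)$, and assume the embedding condition: either $p=1$ and $r/d\ge 1$, or $1<p<\infty$ and $r/d>1/p$ (so that the Sobolev space $W_p^r(Q)$ is embedded into $C(Q)$). Let $F_1$ be the unit ball of $W_p^r(Q)$ with respect to the norm $\|f\|=\big(\sum_{|\alpha|\le r}\|D^\alpha f\|_{L_p(Q)}^p\big)^{1/p}$, and consider the problem $\mathcal P_1$ of approximating $I_1f=\int_Q f(x)\,dx$ for $f\in F_1$, the available information being the point evaluations $\delta_x(f)=f(x)$, $x\in Q$ (values of the continuous representative of $f$). A finite access restriction $\mathcal R=((\Omega,\Sigma,\mathbb P),K',\Lambda')$ consists of a probability space, a finite non-empty set $K'$ and a non-empty set $\Lambda'$ of maps $\lambda':\Omega\to K'$ with $\lambda'^{-1}(\{u\})\in\Sigma$ for all $\lambda'\in\Lambda'$, $u\in K'$. An $\mathcal R$-restricted randomized algorithm $A$ proceeds adaptively: on input $f\in F_1$ and $\omega\in\Omega$, the answers obtained so far determine whether it stops, which element of $\mathbb R$ it outputs when it stops, and, if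 it does not stop, which query it makes next, namely either an information query $\delta_x$ (answered by $f(x)$) or a random query $\lambda'\in\Lambda'$ (answered by $\lambda'(\omega)$); if it never stops, the output is a fixed constant belonging to $A$. Let $A(f,\omega)$ be the output, and let $e^{\rm ran}_{n,k}(\mathcal P_1,\mathcal R)$ be the infimum of $\sup_{f\in F_1}\mathbb E\,|I_1f-A(f,\cdot)|$ over all such algorithms $A$ (with query counts and output measurable in $\omega$) which, for each $f\in F_1$, make in expectation at most $n$ information queries and at most $k$ random queries. Let $\mathcal R$ be any finite access restriction. Then for each $\sigma$ with $0<\sigma\le 1-1/\bar p$ and each $c_0>0$ there are constants $c_1>0$, $c_2\in\mathbb R$ such that for all $n,k\in\mathbb N$ $$e^{\rm ran}_{n,k}(\mathcal P_1,\mathcal R)\le c_0\,n^{-r/d-\sigma}\quad\text{implies}\quad k\ge c_1\,\sigma\log_2 n+c_2 .$$ -/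

import Mathlib

open MeasureTheory
open scoped ENNReal

namespace RestrictedMC

/-! ### Numerical problems and access restrictions -/

/-- An abstract numerical problem `(F, G, S, K, Λ)`: inputs `F`, values `G`, solution operator
`S : F → G`, and a set `Λ` of information functionals `F → K`. -/
structure Problem (F G K : Type*) where
  S : F → G
  info : Set (F → K)
  nonempty_input : Nonempty F
  nonempty_info : info.Nonempty

/-- A probability space `(Ω, Σ, ℙ)` with access restriction: the randomness can only be accessed
through the maps `Ω → K'` in the non-empty set `access`. -/
structure AccessRestriction (Ω K' : Type*) [MeasurableSpace Ω] where
  prob : Measure Ω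
  isProb : IsProbabilityMeasure prob
  access : Set (Ω → K')
  nonempty_access : access.Nonempty

/-- The access restriction is finite: `K'` is finite and `λ⁻¹({u}) ∈ Σ` for all `λ ∈ Λ'`,
`u ∈ K'`. -/
def AccessRestriction.IsFinite {Ω K' : Type*} [MeasurableSpace Ω]
    (R : AccessRestriction Ω K') : Prop :=
  Finite K' ∧ ∀ l ∈ R.access, ∀ u : K', MeasurableSet (l ⁻¹' {u})

/-! ### Restricted randomized algorithms (fully adaptive) -/

section Algorithms

variable {F G K Ω K' : Type*} [MeasurableSpace Ω]

/-- The disjoint union of the information functionals and the access functionals. -/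
abbrev Query (P : Problem F G K) (R : AccessRestriction Ω K') : Type _ :=
  P.info ⊕ R.access

/-- The value of a query at `(f, ω)`, in the disjoint union of `K` and `K'`. -/
def Query.eval {P : Problem F G K} {R : AccessRestriction Ω K'} (q : Query P R)
    (f : F) (ω : Ω) : K ⊕ K' :=
  Sum.map (fun l => l.1 f) (fun l => l.1 ω) q

/-- An `R`-restricted randomized algorithm. `next i` selects the `(i+1)`-st query from the first
`i` answers, `halt i` (with `true` for the value `1`) decides whether to stop after `i` answers,
and `out i` is the output when stopping after `i` answers. For `i = 0` there are no answers and
these are constants. -/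
structure Algorithm (P : Problem F G K) (R : AccessRestriction Ω K') where
  next : (i : ℕ) → (Fin i → K ⊕ K') → Query P R
  halt : (i : ℕ) → (Fin i → K ⊕ K') → Bool
  out : (i : ℕ) → (Fin i → K ⊕ K') → G

namespace Algorithm

variable {P : Problem F G K} {R : AccessRestriction Ω K'}

/-- The first `i` answers at input `(f, ω)`. -/
def answers (A : Algorithm P R) (f : F) (ω : Ω) : (i : ℕ) → (Fin i → K ⊕ K')
  | 0 => Fin.elim0
  | i + 1 => Fin.snoc (α := fun _ => K ⊕ K') (A.answers f ω i)
      (Query.eval (A.next i (A.answers f ω i)) f ω)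

/-- The query made at step `i` (counted from `0`) at input `(f, ω)`. -/
def query (A : Algorithm P R) (f : F) (ω : Ω) (i : ℕ) : Query P R :=
  A.next i (A.answers f ω i)

/-- The total number of queries: the first `n ≥ 0` at which the algorithm stops, and `∞` if there
is no such `n`. -/
noncomputable def card (A : Algorithm P R) (f : F) (ω : Ω) : ℕ∞ :=
  ⨅ (n : ℕ) (_ : A.halt n (A.answers f ω n) = true), (n : ℕ∞)

/-- The number of information queries (queries about the input `f`). -/
noncomputable def cardInfo (A : Algorithm P R) (f : F) (ω : Ω) : ℕ∞ :=
  Set.encard {i : ℕ | (i : ℕ∞) < A.card f ω ∧ (A.query f ω i).isLeft = true}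

/-- The number of random queries (calls of the access functionals). -/
noncomputable def cardRandom (A : Algorithm P R) (f : F) (ω : Ω) : ℕ∞ :=
  Set.encard {i : ℕ | (i : ℕ∞) < A.card f ω ∧ (A.query f ω i).isRight = true}

/-- The output `A(f, ω)`. If the algorithm never stops, the output is the constant `out 0`
(as `ENat.toNat ⊤ = 0`). -/
noncomputable def output (A : Algorithm P R) (f : F) (ω : Ω) : G :=
  A.out (A.card f ω).toNat (A.answers f ω (A.card f ω).toNat)

/-- The algorithm is measurable: for every input the two cardinalities are measurable, and the
output is Borel measurable and almost surely separably valued. -/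
def IsMeas [NormedAddCommGroup G] [NormedSpace ℝ G] (A : Algorithm P R) : Prop :=
  ∀ f : F,
    Measurable (fun ω => A.cardInfo f ω) ∧
    Measurable (fun ω => A.cardRandom f ω) ∧
    @Measurable Ω G _ (borel G) (fun ω => A.output f ω) ∧
    ∃ V : Submodule ℝ G, TopologicalSpace.IsSeparable (V : Set G) ∧
      ∀ᵐ ω ∂(R.prob), A.output f ω ∈ V

/-- The error `sup_{f ∈ F} 𝔼 ‖S(f) - A(f, ω)‖`, with values in `[0, ∞]`. -/
noncomputable def error [NormedAddCommGroup G] (A : Algorithm P R) : ℝ≥0∞ :=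
  ⨆ f : F, ∫⁻ ω, ‖P.S f - A.output f ω‖ₑ ∂(R.prob)

end Algorithm

/-- The measurable algorithms that use, for every input, on average at most `n` information
queries and on average at most `k` random queries. -/
def algorithms [NormedAddCommGroup G] [NormedSpace ℝ G] (P : Problem F G K)
    (R : AccessRestriction Ω K') (n k : ℕ) : Set (Algorithm P R) :=
  {A | A.IsMeas ∧ ∀ f : F,
    ∫⁻ ω, ((A.cardInfo f ω : ℕ∞) : ℝ≥0∞) ∂(R.prob) ≤ (n : ℝ≥0∞) ∧
    ∫⁻ ω, ((A.cardRandom f ω : ℕ∞) : ℝ≥0∞) ∂(R.prob) ≤ (k : ℝ≥0∞)}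

/-- The `(n, k)`-th minimal `R`-restricted randomized error `e^ran_{n,k}(P, R)`. -/
noncomputable def minError [NormedAddCommGroup G] [NormedSpace ℝ G] (P : Problem F G K)
    (R : AccessRestriction Ω K') (n k : ℕ) : ℝ≥0∞ :=
  ⨅ A ∈ algorithms P R n k, A.error

end Algorithms

/-! ### Sobolev spaces on the unit cube -/

/-- The cube `Q = [0,1]^d`. -/
def cube (d : ℕ) : Set (Fin d → ℝ) := Set.Icc 0 1

/-- Lebesgue measure on the cube. -/
noncomputable def cubeMeasure (d : ℕ) : Measure (Fin d → ℝ) := volume.restrict (cube d)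

/-- The space `L_p(Q)`. -/
noncomputable abbrev LpCube (d : ℕ) (p : ℝ) :=
  Lp ℝ (ENNReal.ofReal p) (cubeMeasure d)

/-- The classical partial derivative in the `i`-th coordinate. -/
noncomputable def partialDeriv {d : ℕ} (i : Fin d) (φ : (Fin d → ℝ) → ℝ) : (Fin d → ℝ) → ℝ :=
  fun x => fderiv ℝ φ x (Pi.single i 1)

/-- The classical partial derivative `∂^α φ` of a smooth function, `α` a multi-index. -/
noncomputable def multiDeriv {d : ℕ} (α : Fin d → ℕ) (φ : (Fin d → ℝ) → ℝ) :
    (Fin d → ℝ) → ℝ :=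
  (List.finRange d).foldr (fun i g => (partialDeriv i)^[α i] g) φ

/-- The multi-indices `α` with `|α| ≤ r`. -/
def multiIndices (d r : ℕ) : Finset (Fin d → ℕ) :=
  (Fintype.piFinset fun _ => Finset.range (r + 1)).filter fun α => ∑ i, α i ≤ r

/-- Smooth functions with compact support in the open cube `(0,1)^d`. -/
def IsTestFunction {d : ℕ} (φ : (Fin d → ℝ) → ℝ) : Prop :=
  ContDiff ℝ ((⊤ : ℕ∞) : WithTop ℕ∞) φ ∧ HasCompactSupport φ ∧ tsupport φ ⊆ interior (cube d)

/-- `g` is the weak derivative `D^α f` on the open cube. -/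
def IsWeakDeriv {d : ℕ} (α : Fin d → ℕ) (f g : (Fin d → ℝ) → ℝ) : Prop :=
  ∀ φ : (Fin d → ℝ) → ℝ, IsTestFunction φ →
    ∫ x, f x * multiDeriv α φ x ∂cubeMeasure d =
      (-1) ^ (∑ i, α i) * ∫ x, g x * φ x ∂cubeMeasure d

/-- The closed unit ball of the Sobolev space `W_p^r(Q)` with norm
`‖f‖ = (∑_{|α| ≤ r} ‖D^α f‖_p ^ p) ^ (1/p)`: those `f ∈ L_p(Q)` which have weak derivatives
`D α ∈ L_p(Q)` for all `|α| ≤ r` (these are unique), with norm at most `1`. -/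
def sobolevBall (d r : ℕ) (p : ℝ) : Set (LpCube d p) :=
  {f | ∃ D : (Fin d → ℕ) → LpCube d p,
    (∀ α ∈ multiIndices d r, IsWeakDeriv α f (D α)) ∧
    (∑ α ∈ multiIndices d r, ‖D α‖ ^ p) ^ (1 / p) ≤ 1}

/-- The embedding condition for `W_p^r(Q)` into `C(Q)`. -/
def EmbeddingCondition (d r : ℕ) (p : ℝ) : Prop :=
  (p = 1 ∧ 1 ≤ (r : ℝ) / d) ∨ (1 < p ∧ 1 / p < (r : ℝ) / d)

/-! ### The integration problem -/

/-- `g` is a representative of `f`, continuous on the cube. -/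
def IsContRep {d : ℕ} {p : ℝ} (f : LpCube d p) (g : (Fin d → ℝ) → ℝ) : Prop :=
  ContinuousOn g (cube d) ∧ f =ᵐ[cubeMeasure d] g

/-- The input set `F₁`: the unit ball `B` of `W_p^r(Q)` if the embedding condition holds, and
otherwise those elements of `B` that have a continuous representative. -/
def inputSet (d r : ℕ) (p : ℝ) : Set (LpCube d p) :=
  {f ∈ sobolevBall d r p | ¬ EmbeddingCondition d r p → ∃ g, IsContRep f g}

open Classical in
/-- Point evaluation: the value at `x ∈ Q` of the (on `Q` unique) continuous representative of `f`.
Every element of the input set has one; the default value `0` is for other `f` only. -/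
noncomputable def pointEval {d : ℕ} {p : ℝ} (x : cube d) (f : LpCube d p) : ℝ :=
  if h : ∃ g, IsContRep f g then h.choose x else 0

theorem zero_mem_inputSet (d r : ℕ) (p : ℝ) (hp : 1 ≤ p) : (0 : LpCube d p) ∈ inputSet d r p := by
  have h0 : ((0 : LpCube d p) : (Fin d → ℝ) → ℝ) =ᵐ[cubeMeasure d] 0 := Lp.coeFn_zero _ _ _
  refine ⟨⟨fun _ => 0, ?_, ?_⟩, fun _ => ⟨0, continuousOn_const, h0⟩⟩
  · intro α _ φ _
    have key : ∀ ψ : (Fin d → ℝ) → ℝ,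
        ∫ x, ((0 : LpCube d p) : (Fin d → ℝ) → ℝ) x * ψ x ∂cubeMeasure d = 0 := by
      intro ψ
      rw [integral_eq_zero_of_ae]
      filter_upwards [h0] with x hx
      rw [hx, Pi.zero_apply, zero_mul]
    rw [key, key, mul_zero]
  · have hp0 : p ≠ 0 := by linarith
    simp [Lp.norm_zero, Real.zero_rpow hp0, hp0]

/-- The integration problem `P₁ = (F₁, ℝ, I₁, ℝ, Λ₁)`, where `I₁ f = ∫_Q f(x) dx` and `Λ₁` is the
set of all point evaluations at points of `Q`. -/
noncomputable def integrationProblem (d r : ℕ) (p : ℝ) (hp : 1 ≤ p) :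
    Problem (inputSet d r p) ℝ ℝ where
  S f := ∫ x, (f : LpCube d p) x ∂cubeMeasure d
  info := Set.range fun (x : cube d) (f : inputSet d r p) => pointEval x (f : LpCube d p)
  nonempty_input := ⟨⟨0, zero_mem_inputSet d r p hp⟩⟩
  nonempty_info := ⟨_, ⟨⟨0, Set.left_mem_Icc.2 zero_le_one⟩, rfl⟩⟩

end RestrictedMC

/-! A few random queries with finitely many answers produce only few different runs on a fixed
input, so the algorithm is nearly deterministic, and for deterministic information the rate is no
better than `n ^ (-r/d)`.

Run `A` on the zero function. By Markov's inequality, with probability at least `1/2` it makes at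
most `4n` information and `4k` random queries. All such runs are governed by a tape in `K' ^ (4k)`,
so together they probe at most `M = 4n (2|K'|) ^ (4k)` points of the cube (`exists_probes`). Some
function in the Sobolev ball vanishes at all these points and has integral at least `c M ^ (-r/d)`
(`exists_fooling_function`). On the event of probability `1/2` the algorithm cannot tell it from
zero, so its error is at least `(c/4) M ^ (-r/d)` (`exists_lower_bound_error`).

If this is at most `c₀ n ^ (-r/d-σ)`, the factor `n ^ (-r/d)` cancels, and logarithms give `σ log₂ n
≤ 4k (r/d) log₂ (2|K'|) + const`. -/

namespace RestrictedMC

/-! ### Simulating a randomized run by a finite tape -/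

section Simulation

variable {F G K Ω K' : Type*} [MeasurableSpace Ω] {P : Problem F G K} {R : AccessRestriction Ω K'}

namespace Algorithm

/-- The run of `A` at input `f` in which the random queries are answered from the tape `w`: the
first `i` answers, and the number of tape entries read so far. -/
def tapeRun (A : Algorithm P R) (f : F) (w : ℕ → K') : (i : ℕ) → (Fin i → K ⊕ K') × ℕ
  | 0 => (Fin.elim0, 0)
  | i + 1 =>
    let s := A.tapeRun f w i
    match A.next i s.1 with
    | .inl l => (Fin.snoc (α := fun _ => K ⊕ K') s.1 (.inl (l.1 f)), s.2)
    | .inr _ => (Fin.snoc (α := fun _ => K ⊕ K') s.1 (.inr (w s.2)), s.2 + 1)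

/-- Only the answer to a random query affects the run, so a tape listing these answers in the order
of the queries reproduces it. The cell read at step `i` is indexed by the number of earlier random
queries. -/
theorem tapeRun_eq_answers (A : Algorithm P R) (f : F) (ω : Ω) (w : ℕ → K') (m : ℕ)
    (hw : ∀ i < m, ∀ l, A.query f ω i = .inr l →
      w (Nat.count (fun i => (A.query f ω i).isRight = true) i) = l.1 ω) :
    ∀ i ≤ m, A.tapeRun f w i =
      (A.answers f ω i, Nat.count (fun i => (A.query f ω i).isRight = true) i) := by
  intro i
  induction i with
  | zero => intro _; simp [tapeRun, answers]
  | succ i ih =>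
    intro hi
    have h := ih (by omega)
    have hwi := hw i (by omega)
    rw [Nat.count_succ]
    simp only [tapeRun, answers, h]
    unfold query at hwi ⊢
    rcases hq : A.next i (A.answers f ω i) with l | l
    · simp [Query.eval]
    · simp [Query.eval, ← hwi l hq]

theorem halt_of_card_eq (A : Algorithm P R) (f : F) (ω : Ω) (m : ℕ) (h : A.card f ω = m) :
    A.halt m (A.answers f ω m) = true := by
  by_contra hm
  have h1 : ((m + 1 : ℕ) : ℕ∞) ≤ A.card f ω := by
    refine le_iInf₂ fun j hj => ?_
    have h2 : (m : ℕ∞) ≤ j := h ▸ iInf₂_le j hj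
    have h3 : m ≠ j := by rintro rfl; exact hm hj
    have h4 : m ≤ j := by exact_mod_cast h2
    exact_mod_cast (by omega : m + 1 ≤ j)
  rw [h] at h1
  have : m + 1 ≤ m := by exact_mod_cast h1
  omega

theorem card_eq_of_answers_eq (A : Algorithm P R) (f g : F) (ω : Ω) (m : ℕ)
    (h : A.card f ω = m) (hfg : ∀ i ≤ m, A.answers g ω i = A.answers f ω i) :
    A.card g ω = m := by
  apply le_antisymm
  · exact iInf₂_le m (by rw [hfg m le_rfl]; exact A.halt_of_card_eq f ω m h)
  · refine le_iInf₂ fun j hj => ?_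
    by_contra hjm
    have hjm' : j < m := by exact_mod_cast not_le.1 hjm
    rw [hfg j hjm'.le] at hj
    have h2 : (m : ℕ∞) ≤ j := h ▸ iInf₂_le j hj
    exact hjm h2

theorem card_le_cardInfo_add_cardRandom (A : Algorithm P R) (f : F) (ω : Ω) :
    A.card f ω ≤ A.cardInfo f ω + A.cardRandom f ω := by
  have hsub : ∀ m : ℕ, (m : ℕ∞) ≤ A.card f ω → (m : ℕ∞) ≤ A.cardInfo f ω + A.cardRandom f ω := by
    intro m hm
    calc (m : ℕ∞) = Set.encard (↑(Finset.range m) : Set ℕ) := by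
            rw [Set.encard_coe_eq_coe_finsetCard, Finset.card_range]
      _ ≤ _ := Set.encard_le_encard (fun i hi => by
            have hi' : i < m := by simpa using hi
            have h1 : (i : ℕ∞) < A.card f ω := lt_of_lt_of_le (by exact_mod_cast hi') hm
            rcases hq : A.query f ω i with l | l
            · exact Or.inl ⟨h1, by rw [hq]; rfl⟩
            · exact Or.inr ⟨h1, by rw [hq]; rfl⟩)
      _ ≤ _ := Set.encard_union_le _ _
  rcases h : A.card f ω with _ | m
  · rw [h] at hsub
    refine (ENat.eq_top_iff_forall_ge.2 fun m => hsub m le_top).ge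
  · exact hsub m (by rw [h]; rfl)

/-- The query at step `i` is itself random, so it adds one to the earlier ones. The inequality is
therefore strict, and a tape with `k` cells suffices. -/
theorem count_random_lt (A : Algorithm P R) (f : F) (ω : Ω) (k i : ℕ)
    (hk : A.cardRandom f ω ≤ k) (hi : (i : ℕ∞) < A.card f ω)
    (hq : (A.query f ω i).isRight = true) :
    Nat.count (fun i => (A.query f ω i).isRight = true) i < k := by
  have h1 : ((Nat.count (fun i => (A.query f ω i).isRight = true) (i + 1) : ℕ) : ℕ∞) ≤ k := by
    refine le_trans ?_ hk
    rw [Nat.count_eq_card_filter_range, ← Set.encard_coe_eq_coe_finsetCard]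
    refine Set.encard_le_encard fun j hj => ?_
    simp only [Finset.coe_filter, Finset.mem_range, Set.mem_ofPred_eq] at hj
    refine ⟨lt_of_le_of_lt ?_ hi, hj.2⟩
    exact_mod_cast Nat.lt_succ_iff.1 hj.1
  rw [Nat.count_succ, if_pos hq] at h1
  have : Nat.count (fun i => (A.query f ω i).isRight = true) i + 1 ≤ k := by exact_mod_cast h1
  omega

/-- Finitely many information functionals decide the output at all inputs that agree with `f₀` on
them, for all `ω` for which `A` makes at most `N` information and `k` random queries at `f₀`. -/
theorem exists_probes (A : Algorithm P R) (f₀ : F) (N k : ℕ) [NeZero k] :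
    ∃ g : (Fin k → K') × Fin (N + k) → P.info, ∀ f : F,
      (∀ t, (g t).1 f = (g t).1 f₀) → ∀ ω, A.cardInfo f₀ ω ≤ N → A.cardRandom f₀ ω ≤ k →
        A.output f ω = A.output f₀ ω := by
  classical
  let l₀ : P.info := ⟨_, P.nonempty_info.some_mem⟩
  -- The wrap-around modulo `k` only makes the tape total; the runs considered read cells below `k`.
  let tape : (Fin k → K') → ℕ → K' := fun w j => w (Fin.ofNat k j)
  -- A probe for every tape and every step; steps at which a random query is made receive the dummy
  -- `l₀`.
  refine ⟨fun t => Sum.elim id (fun _ => l₀) (A.next t.2 (A.tapeRun f₀ (tape t.1) t.2).1), ?_⟩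
  intro f hf ω hN hk
  have hcard : A.card f₀ ω ≤ ((N + k : ℕ) : ℕ∞) := by
    refine (A.card_le_cardInfo_add_cardRandom f₀ ω).trans ?_
    push_cast
    exact add_le_add hN hk
  obtain ⟨m, hm⟩ := ENat.ne_top_iff_exists.1 (ne_top_of_le_ne_top (ENat.natCast_ne_top _) hcard)
  have hm := hm.symm
  have hmN : m ≤ N + k := by rw [hm] at hcard; exact_mod_cast hcard
  set q : ℕ → Prop := fun i => (A.query f₀ ω i).isRight = true with hqdef
  have hex : ∃ w : Fin k → K', ∀ i < m, ∀ l, A.query f₀ ω i = .inr l →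
      tape w (Nat.count q i) = l.1 ω := by
    -- Cell `j` holds the answer to the `j`-th random query of the actual run; the default fills
    -- cells for which there is none.
    let w : Fin k → K' := fun j =>
      Sum.elim (fun _ => R.nonempty_access.some ω) (fun l => l.1 ω)
        (A.query f₀ ω (Nat.nth q j))
    refine ⟨w, fun i hi l hl => ?_⟩
    have hqi : q i := by simp [hqdef, hl]
    have hlt : Nat.count q i < k :=
      A.count_random_lt f₀ ω k i hk (by rw [hm]; exact_mod_cast hi) hqi
    simp only [tape, w, Fin.val_ofNat, Nat.mod_eq_of_lt hlt, Nat.nth_count hqi, hl, Sum.elim_inr]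
  obtain ⟨w, hw⟩ := hex
  have hrun := A.tapeRun_eq_answers f₀ ω (tape w) m hw
  have hans : ∀ i ≤ m, A.answers f ω i = A.answers f₀ ω i := by
    intro i
    induction i with
    | zero => intro _; rfl
    | succ i ih =>
      intro hi
      have h := ih (by omega)
      have ht := hf (w, ⟨i, by omega⟩)
      simp only [hrun i (by omega)] at ht
      simp only [answers, h]
      rcases hq : A.next i (A.answers f₀ ω i) with l | l
      · rw [hq] at ht
        have ht' : l.1 f = l.1 f₀ := ht
        simp [Query.eval, ht']
      · simp [Query.eval]
  have hc := A.card_eq_of_answers_eq f₀ f ω m hm hans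
  unfold output
  rw [hc, hm, ENat.toNat_natCast, hans m le_rfl]

end Algorithm

/-! ### From indistinguishable inputs to a lower bound for the error -/

theorem half_le_measure_card_le [NormedAddCommGroup G] [NormedSpace ℝ G] {n k : ℕ} (hn : n ≠ 0)
    (hk : k ≠ 0) {A : Algorithm P R} (hA : A ∈ algorithms P R n k) (f : F) :
    MeasurableSet {ω | A.cardInfo f ω ≤ (4 * n : ℕ) ∧ A.cardRandom f ω ≤ (4 * k : ℕ)} ∧
    2⁻¹ ≤ R.prob {ω | A.cardInfo f ω ≤ (4 * n : ℕ) ∧ A.cardRandom f ω ≤ (4 * k : ℕ)} := by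
  have := R.isProb
  obtain ⟨hmeas, hcost⟩ := hA
  obtain ⟨h1, h2, -⟩ := hmeas f
  obtain ⟨c1, c2⟩ := hcost f
  have hcast : Measurable (fun x : ℕ∞ => (x : ℝ≥0∞)) := by measurability
  -- Markov's inequality: each of the two budgets is exceeded fourfold with probability at most
  -- `1/4`.
  have key : ∀ (X : Ω → ℕ∞) (a : ℕ), a ≠ 0 → Measurable X →
      ∫⁻ ω, ((X ω : ℕ∞) : ℝ≥0∞) ∂(R.prob) ≤ a →
      R.prob {ω | ¬ X ω ≤ (4 * a : ℕ)} ≤ 4⁻¹ := by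
    intro X a ha hX hE
    have ha' : (a : ℝ≥0∞) ≠ 0 := by exact_mod_cast ha
    calc R.prob {ω | ¬ X ω ≤ (4 * a : ℕ)}
        ≤ R.prob {ω | ((4 * a : ℕ) : ℝ≥0∞) ≤ (X ω : ℝ≥0∞)} := by
          refine measure_mono fun ω hω => ?_
          have h := (not_le.1 hω).le
          have : (((4 * a : ℕ) : ℕ∞) : ℝ≥0∞) ≤ (X ω : ℝ≥0∞) := by exact_mod_cast h
          simpa using this
      _ ≤ (∫⁻ ω, ((X ω : ℕ∞) : ℝ≥0∞) ∂(R.prob)) / ((4 * a : ℕ) : ℝ≥0∞) :=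
          meas_ge_le_lintegral_div (hcast.comp hX).aemeasurable
            (by exact_mod_cast (by omega : 4 * a ≠ 0)) (ENNReal.natCast_ne_top _)
      _ ≤ a / ((4 * a : ℕ) : ℝ≥0∞) := by gcongr
      _ = 4⁻¹ := by
          push_cast
          rw [ENNReal.div_eq_inv_mul, ENNReal.mul_inv (by simp) (by simp), mul_assoc,
            ENNReal.inv_mul_cancel ha' (by simp), mul_one]
  have hset : MeasurableSet
      {ω | A.cardInfo f ω ≤ (4 * n : ℕ) ∧ A.cardRandom f ω ≤ (4 * k : ℕ)} :=
    (h1 (MeasurableSet.of_discrete (s := Set.Iic _))).inter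
      (h2 (MeasurableSet.of_discrete (s := Set.Iic _)))
  refine ⟨hset, ?_⟩
  have hcompl : R.prob {ω | A.cardInfo f ω ≤ (4 * n : ℕ) ∧ A.cardRandom f ω ≤ (4 * k : ℕ)}ᶜ
      ≤ 2⁻¹ := by
    calc _ ≤ R.prob ({ω | ¬ A.cardInfo f ω ≤ (4 * n : ℕ)} ∪
            {ω | ¬ A.cardRandom f ω ≤ (4 * k : ℕ)}) := by
          refine measure_mono fun ω hω => ?_
          exact not_and_or.1 hω
      _ ≤ _ := measure_union_le _ _
      _ ≤ 4⁻¹ + 4⁻¹ := add_le_add (key _ n hn h1 c1) (key _ k hk h2 c2)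
      _ = 2⁻¹ := by
          rw [show (4 : ℝ≥0∞) = 2 * 2 by norm_num, ENNReal.mul_inv (by simp) (by simp), ← mul_add,
            ENNReal.inv_two_add_inv_two, mul_one]
  rw [prob_compl_eq_one_sub hset] at hcompl
  have h := tsub_le_iff_left.1 hcompl
  rw [← ENNReal.inv_two_add_inv_two] at h
  exact (ENNReal.add_le_add_iff_right (by simp)).1 h

/-- Two inputs that `A` cannot distinguish with probability at least `1/2` have solutions at
distance at most `4` times the error. -/
theorem enorm_sub_le_four_mul_error {P : Problem F ℝ K} {A : Algorithm P R} (hA : A.IsMeas)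
    {f g : F} {s : Set Ω} (hs : MeasurableSet s) (hs2 : 2⁻¹ ≤ R.prob s)
    (hfg : ∀ ω ∈ s, A.output f ω = A.output g ω) :
    ‖P.S f - P.S g‖ₑ ≤ 4 * A.error := by
  have hle : ∀ f : F, ∫⁻ ω, ‖P.S f - A.output f ω‖ₑ ∂(R.prob) ≤ A.error := fun f =>
    le_iSup (fun f : F => ∫⁻ ω, ‖P.S f - A.output f ω‖ₑ ∂(R.prob)) f
  have hout : Measurable fun ω => A.output f ω := by
    have h := (hA f).2.2.1
    rwa [← BorelSpace.measurable_eq (α := ℝ)] at h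
  -- On `s` the common output is compared with both solutions by the triangle inequality.
  have h1 : ‖P.S f - P.S g‖ₑ * 2⁻¹ ≤ 2 * A.error := by
    calc ‖P.S f - P.S g‖ₑ * 2⁻¹ ≤ ‖P.S f - P.S g‖ₑ * R.prob s := by gcongr
      _ = ∫⁻ _ in s, ‖P.S f - P.S g‖ₑ ∂(R.prob) := (setLIntegral_const _ _).symm
      _ ≤ ∫⁻ ω in s, (‖P.S f - A.output f ω‖ₑ + ‖P.S g - A.output g ω‖ₑ) ∂(R.prob) := by
          refine setLIntegral_mono' hs fun ω hω => ?_
          rw [hfg ω hω, ← edist_eq_enorm_sub, ← edist_eq_enorm_sub, ← edist_eq_enorm_sub]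
          exact edist_triangle_right _ _ _
      _ ≤ ∫⁻ ω, (‖P.S f - A.output f ω‖ₑ + ‖P.S g - A.output g ω‖ₑ) ∂(R.prob) :=
          setLIntegral_le_lintegral _ _
      _ = ∫⁻ ω, ‖P.S f - A.output f ω‖ₑ ∂(R.prob) + ∫⁻ ω, ‖P.S g - A.output g ω‖ₑ ∂(R.prob) :=
          lintegral_add_left (by fun_prop) _
      _ ≤ A.error + A.error := add_le_add (hle f) (hle g)
      _ = 2 * A.error := (two_mul _).symm
  calc ‖P.S f - P.S g‖ₑ = ‖P.S f - P.S g‖ₑ * 2⁻¹ * 2 := by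
        rw [mul_assoc, ENNReal.inv_mul_cancel (by simp) (by simp), mul_one]
    _ ≤ 2 * A.error * 2 := by gcongr
    _ = 4 * A.error := by ring

end Simulation

end RestrictedMC

namespace RestrictedMC

/-! ### Weak derivatives of smooth functions -/

section Smooth

open scoped ContDiff

variable {d : ℕ}

theorem contDiff_partialDeriv (i : Fin d) {φ : (Fin d → ℝ) → ℝ} (h : ContDiff ℝ ∞ φ) :
    ContDiff ℝ ∞ (partialDeriv i φ) :=
  (h.fderiv_right (m := ∞) (by simp)).clm_apply contDiff_const

theorem tsupport_partialDeriv_subset (i : Fin d) (φ : (Fin d → ℝ) → ℝ) :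
    tsupport (partialDeriv i φ) ⊆ tsupport φ :=
  tsupport_fderiv_apply_subset ℝ _

theorem IsTestFunction.partialDeriv (i : Fin d) {φ : (Fin d → ℝ) → ℝ} (h : IsTestFunction φ) :
    IsTestFunction (partialDeriv i φ) :=
  ⟨contDiff_partialDeriv i h.1, h.2.1.fderiv_apply ℝ _,
    (tsupport_partialDeriv_subset i φ).trans h.2.2⟩

theorem IsTestFunction.iterate_partialDeriv (i : Fin d) (a : ℕ) {φ : (Fin d → ℝ) → ℝ}
    (h : IsTestFunction φ) : IsTestFunction ((RestrictedMC.partialDeriv i)^[a] φ) := by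
  induction a generalizing φ with
  | zero => exact h
  | succ a ih => exact ih (h.partialDeriv i)

theorem contDiff_iterate_partialDeriv (i : Fin d) (a : ℕ) {φ : (Fin d → ℝ) → ℝ}
    (h : ContDiff ℝ ∞ φ) : ContDiff ℝ ∞ ((partialDeriv i)^[a] φ) := by
  induction a generalizing φ with
  | zero => exact h
  | succ a ih => exact ih (contDiff_partialDeriv i h)

/-- The iterated partial derivatives along `l`, applied in the order opposite to that of
`multiDeriv`. -/
noncomputable def revDeriv (α : Fin d → ℕ) (l : List (Fin d)) (f : (Fin d → ℝ) → ℝ) :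
    (Fin d → ℝ) → ℝ :=
  l.foldl (fun g i => (partialDeriv i)^[α i] g) f

theorem contDiff_revDeriv (α : Fin d → ℕ) (l : List (Fin d)) {f : (Fin d → ℝ) → ℝ}
    (h : ContDiff ℝ ∞ f) : ContDiff ℝ ∞ (revDeriv α l f) := by
  induction l generalizing f with
  | nil => exact h
  | cons i l ih => exact ih (contDiff_iterate_partialDeriv i (α i) h)

theorem IsTestFunction.revDeriv (α : Fin d → ℕ) (l : List (Fin d)) {f : (Fin d → ℝ) → ℝ}
    (h : IsTestFunction f) : IsTestFunction (revDeriv α l f) := by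
  induction l generalizing f with
  | nil => exact h
  | cons i l ih => exact ih (h.iterate_partialDeriv i (α i))

theorem integral_mul_partialDeriv (i : Fin d) {f φ : (Fin d → ℝ) → ℝ} (hf : ContDiff ℝ ∞ f)
    (hφ : IsTestFunction φ) :
    ∫ x, f x * partialDeriv i φ x = - ∫ x, partialDeriv i f x * φ x := by
  have hf' := contDiff_partialDeriv i hf
  have hφ' := hφ.partialDeriv i
  refine integral_mul_fderiv_eq_neg_fderiv_mul_of_integrable ?_ ?_ ?_
    (fun x _ => hf.differentiable (by simp) x) (fun x _ => hφ.1.differentiable (by simp) x)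
  · exact (hf'.continuous.mul hφ.1.continuous).integrable_of_hasCompactSupport hφ.2.1.mul_left
  · exact (hf.continuous.mul hφ'.1.continuous).integrable_of_hasCompactSupport hφ'.2.1.mul_left
  · exact (hf.continuous.mul hφ.1.continuous).integrable_of_hasCompactSupport hφ.2.1.mul_left

theorem integral_mul_iterate_partialDeriv (i : Fin d) (a : ℕ) {f φ : (Fin d → ℝ) → ℝ}
    (hf : ContDiff ℝ ∞ f) (hφ : IsTestFunction φ) :
    ∫ x, f x * (partialDeriv i)^[a] φ x = (-1) ^ a * ∫ x, (partialDeriv i)^[a] f x * φ x := by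
  induction a generalizing f with
  | zero => simp
  | succ a ih =>
    rw [Function.iterate_succ_apply', integral_mul_partialDeriv i hf (hφ.iterate_partialDeriv i a),
      ih (contDiff_partialDeriv i hf), Function.iterate_succ_apply, pow_succ]
    ring

theorem isTestFunction_foldr (α : Fin d → ℕ) (l : List (Fin d)) {φ : (Fin d → ℝ) → ℝ}
    (hφ : IsTestFunction φ) :
    IsTestFunction (l.foldr (fun i g => (partialDeriv i)^[α i] g) φ) := by
  induction l with
  | nil => exact hφ
  | cons i l ih => exact ih.iterate_partialDeriv i (α i)

/-- Integration by parts moves the outermost derivative of `φ` first, so the derivatives reach `f`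
in reverse order. Working with `revDeriv` avoids commuting partial derivatives. -/
theorem integral_mul_foldr (α : Fin d → ℕ) (l : List (Fin d)) {f φ : (Fin d → ℝ) → ℝ}
    (hf : ContDiff ℝ ∞ f) (hφ : IsTestFunction φ) :
    ∫ x, f x * l.foldr (fun i g => (partialDeriv i)^[α i] g) φ x =
      (-1) ^ (l.map α).sum * ∫ x, revDeriv α l f x * φ x := by
  induction l generalizing f with
  | nil => simp [revDeriv]
  | cons i l ih =>
    rw [List.foldr_cons, integral_mul_iterate_partialDeriv i _ hf (isTestFunction_foldr α l hφ),
      ih (contDiff_iterate_partialDeriv i _ hf), List.map_cons, List.sum_cons, pow_add, mul_assoc]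
    rfl

theorem setIntegral_cube_mul (f : (Fin d → ℝ) → ℝ) {φ : (Fin d → ℝ) → ℝ}
    (hφ : IsTestFunction φ) :
    ∫ x, f x * φ x ∂cubeMeasure d = ∫ x, f x * φ x := by
  refine setIntegral_eq_integral_of_forall_compl_eq_zero fun x hx => ?_
  rw [image_eq_zero_of_notMem_tsupport (fun h => hx (interior_subset (hφ.2.2 h))), mul_zero]

theorem isWeakDeriv_revDeriv (α : Fin d → ℕ) {f : (Fin d → ℝ) → ℝ} (hf : ContDiff ℝ ∞ f) :
    IsWeakDeriv α f (revDeriv α (List.finRange d) f) := by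
  intro φ hφ
  have h := integral_mul_foldr α (List.finRange d) hf hφ
  have hφ' : IsTestFunction (multiDeriv α φ) := isTestFunction_foldr α (List.finRange d) hφ
  rw [setIntegral_cube_mul _ hφ, setIntegral_cube_mul f hφ']
  rw [← List.ofFn_eq_map, List.sum_ofFn] at h
  exact h

theorem IsWeakDeriv.congr {α : Fin d → ℕ} {f f' g g' : (Fin d → ℝ) → ℝ} (h : IsWeakDeriv α f g)
    (hf : f' =ᵐ[cubeMeasure d] f) (hg : g' =ᵐ[cubeMeasure d] g) : IsWeakDeriv α f' g' := by
  intro φ hφ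
  rw [integral_congr_ae (hf.mono fun x hx => by simp only [hx] : (fun x => f' x * multiDeriv α φ x)
      =ᵐ[cubeMeasure d] fun x => f x * multiDeriv α φ x),
    integral_congr_ae (hg.mono fun x hx => by simp only [hx] : (fun x => g' x * φ x)
      =ᵐ[cubeMeasure d] fun x => g x * φ x)]
  exact h φ hφ

end Smooth

/-! ### Point values and membership in the Sobolev ball -/

section Cube

variable {d : ℕ}

instance isProbabilityMeasure_cubeMeasure : IsProbabilityMeasure (cubeMeasure d) := by
  constructor
  rw [cubeMeasure, Measure.restrict_apply_univ, cube, Real.volume_Icc_pi]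
  simp

theorem interior_cube : interior (cube d) = Set.univ.pi fun _ => Set.Ioo (0 : ℝ) 1 := by
  rw [cube, ← Set.pi_univ_Icc, interior_pi_set Set.finite_univ]
  simp

theorem cube_subset_closure_interior : cube d ⊆ closure (interior (cube d)) := by
  rw [interior_cube, closure_pi_set, cube, ← Set.pi_univ_Icc]
  simp

/-- Continuous representatives agree almost everywhere, hence everywhere on the cube, since it lies
in the closure of its interior. -/
theorem pointEval_eq {p : ℝ} {f : LpCube d p} {g : (Fin d → ℝ) → ℝ} (h : IsContRep f g)
    (x : cube d) : pointEval x f = g x := by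
  have hex : ∃ g, IsContRep f g := ⟨g, h⟩
  rw [pointEval, dif_pos hex]
  have hc := hex.choose_spec
  exact Measure.eqOn_of_ae_eq (μ := volume) (hc.2.symm.trans h.2) hc.1 h.1
    cube_subset_closure_interior x.2

open scoped ContDiff in
/-- A smooth function whose partial derivatives up to order `r` are small on the cube is an element
of the Sobolev ball. -/
theorem exists_mem_inputSet (r : ℕ) {p : ℝ} (hp : 1 ≤ p) {f : (Fin d → ℝ) → ℝ}
    (hf : ContDiff ℝ ∞ f) {b : ℝ} (hb0 : 0 ≤ b) (hb1 : (multiIndices d r).card * b ≤ 1)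
    (hb : ∀ α ∈ multiIndices d r, ∀ x ∈ cube d, |revDeriv α (List.finRange d) f x| ≤ b) :
    ∃ F ∈ inputSet d r p, IsContRep F f := by
  have hp0 : 0 < p := by linarith
  have : Fact (1 ≤ ENNReal.ofReal p) := ⟨by simpa using hp⟩
  have hmem : ∀ g : (Fin d → ℝ) → ℝ, ContDiff ℝ ∞ g →
      MemLp g (ENNReal.ofReal p) (cubeMeasure d) := by
    intro g hg
    have hcomp : IsCompact (cube d) := isCompact_Icc
    obtain ⟨C, hC⟩ := hcomp.exists_bound_of_continuousOn hg.continuous.continuousOn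
    exact MemLp.of_bound hg.continuous.aestronglyMeasurable C
      ((ae_restrict_iff' measurableSet_Icc).2 (.of_forall hC))
  have hrev := fun α : Fin d → ℕ => hmem _ (contDiff_revDeriv α (List.finRange d) hf)
  have hrep : IsContRep ((hmem f hf).toLp f) f :=
    ⟨hf.continuous.continuousOn, (hmem f hf).coeFn_toLp⟩
  refine ⟨(hmem f hf).toLp f, ⟨⟨fun α => (hrev α).toLp _, fun α _ => ?_, ?_⟩, fun _ => ⟨f, hrep⟩⟩,
    hrep⟩
  · exact (isWeakDeriv_revDeriv α hf).congr (hmem f hf).coeFn_toLp (hrev α).coeFn_toLp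
  · have hbound : ∀ α ∈ multiIndices d r,
        ‖((hrev α).toLp _ : LpCube d p)‖ ^ p ≤ b := by
      intro α hα
      have h1 : ‖((hrev α).toLp _ : LpCube d p)‖ ≤ b := by
        refine (Lp.norm_le_of_ae_bound hb0 (C := b) ?_).trans ?_
        · filter_upwards [(hrev α).coeFn_toLp, ae_restrict_mem (measurableSet_Icc)] with x hx hx'
          rw [hx]
          exact hb α hα x hx'
        · simp [measureUnivNNReal]
      have hb1' : b ≤ 1 := by
        have hpos : (1 : ℝ) ≤ (multiIndices d r).card := by
          exact_mod_cast Finset.card_pos.2 ⟨α, hα⟩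
        nlinarith
      calc _ ≤ b ^ p := Real.rpow_le_rpow (norm_nonneg _) h1 hp0.le
        _ ≤ b ^ (1 : ℝ) := by
            rcases hb0.eq_or_lt with h | h
            · subst h; simp [Real.zero_rpow hp0.ne']
            · exact Real.rpow_le_rpow_of_exponent_ge h hb1' hp
        _ = b := Real.rpow_one b
    refine Real.rpow_le_one (Finset.sum_nonneg fun α _ => by positivity) ?_ (by positivity)
    calc _ ≤ ∑ _α ∈ multiIndices d r, b := Finset.sum_le_sum hbound
      _ ≤ 1 := by simpa using hb1

end Cube

end RestrictedMC

namespace RestrictedMC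

/-! ### Fooling functions built from scaled bumps -/

section Bumps

open scoped ContDiff

variable {d : ℕ}

/-- The lower left corner, scaled by `m`, of a cube of the regular partition of `[0,1]^d` into
`m ^ d` cubes. -/
def corner {m : ℕ} (j : Fin d → Fin m) : Fin d → ℝ := fun i => ((j i : ℕ) : ℝ)

/-- The sum of copies of `ψ`, scaled to the cubes of the regular partition with index in `S`. -/
noncomputable def bumpSum (m : ℕ) (S : Finset (Fin d → Fin m)) (ψ : (Fin d → ℝ) → ℝ) :
    (Fin d → ℝ) → ℝ :=
  fun x => ∑ j ∈ S, ψ ((m : ℝ) • x - corner j)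

theorem contDiff_bumpSum (m : ℕ) (S : Finset (Fin d → Fin m)) {ψ : (Fin d → ℝ) → ℝ}
    (hψ : ContDiff ℝ ∞ ψ) : ContDiff ℝ ∞ (bumpSum m S ψ) :=
  ContDiff.sum fun _ _ => hψ.comp ((contDiff_id.const_smul _).sub contDiff_const)

theorem partialDeriv_smul_bumpSum (i : Fin d) (c : ℝ) (m : ℕ) (S : Finset (Fin d → Fin m))
    {ψ : (Fin d → ℝ) → ℝ} (hψ : ContDiff ℝ ∞ ψ) :
    partialDeriv i (c • bumpSum m S ψ) = (c * m) • bumpSum m S (partialDeriv i ψ) := by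
  funext x
  have h1 : ∀ j : Fin d → Fin m, HasFDerivAt (fun x => ψ ((m : ℝ) • x - corner j))
      ((fderiv ℝ ψ ((m : ℝ) • x - corner j)).comp
        ((m : ℝ) • ContinuousLinearMap.id ℝ (Fin d → ℝ))) x := fun j =>
    ((hψ.differentiable (by simp) _).hasFDerivAt).comp x
      (((hasFDerivAt_id x).const_smul (m : ℝ)).sub_const (corner j))
  have h2 : HasFDerivAt (c • bumpSum m S ψ) _ x :=
    (HasFDerivAt.fun_sum fun j (_ : j ∈ S) => h1 j).const_smul c
  rw [partialDeriv, h2.fderiv]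
  simp [bumpSum, partialDeriv, Finset.mul_sum, mul_assoc]

theorem iterate_partialDeriv_smul_bumpSum (i : Fin d) (a : ℕ) (c : ℝ) (m : ℕ)
    (S : Finset (Fin d → Fin m)) {ψ : (Fin d → ℝ) → ℝ} (hψ : ContDiff ℝ ∞ ψ) :
    (partialDeriv i)^[a] (c • bumpSum m S ψ) =
      (c * m ^ a) • bumpSum m S ((partialDeriv i)^[a] ψ) := by
  induction a generalizing c ψ with
  | zero => simp
  | succ a ih =>
    rw [Function.iterate_succ_apply, partialDeriv_smul_bumpSum i c m S hψ,
      ih _ (contDiff_partialDeriv i hψ), Function.iterate_succ_apply, pow_succ']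
    ring_nf

theorem revDeriv_smul_bumpSum (α : Fin d → ℕ) (l : List (Fin d)) (c : ℝ) (m : ℕ)
    (S : Finset (Fin d → Fin m)) {ψ : (Fin d → ℝ) → ℝ} (hψ : ContDiff ℝ ∞ ψ) :
    revDeriv α l (c • bumpSum m S ψ) =
      (c * m ^ (l.map α).sum) • bumpSum m S (revDeriv α l ψ) := by
  induction l generalizing c ψ with
  | nil => simp [revDeriv]
  | cons i l ih =>
    have h := ih (c * m ^ α i) (contDiff_iterate_partialDeriv i (α i) hψ)
    rw [← iterate_partialDeriv_smul_bumpSum i (α i) c m S hψ] at h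
    rw [List.map_cons, List.sum_cons, pow_add, ← mul_assoc]
    exact h

theorem IsTestFunction.mem_Ioo {ψ : (Fin d → ℝ) → ℝ} (hψ : IsTestFunction ψ) {y : Fin d → ℝ}
    (hy : ψ y ≠ 0) (i : Fin d) : y i ∈ Set.Ioo (0 : ℝ) 1 := by
  have h := hψ.2.2 (subset_tsupport ψ hy)
  rw [interior_cube] at h
  exact h i trivial

/-- The scaled bumps live on disjoint open cubes: corner coordinates are integers, and here they
differ by less than one. -/
theorem eq_of_bump_ne_zero {m : ℕ} {ψ : (Fin d → ℝ) → ℝ} (hψ : IsTestFunction ψ) {x : Fin d → ℝ}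
    {j j' : Fin d → Fin m} (h : ψ ((m : ℝ) • x - corner j) ≠ 0)
    (h' : ψ ((m : ℝ) • x - corner j') ≠ 0) : j = j' := by
  funext i
  obtain ⟨h1, h2⟩ := hψ.mem_Ioo h i
  obtain ⟨h3, h4⟩ := hψ.mem_Ioo h' i
  simp only [corner, Pi.sub_apply] at h1 h2 h3 h4
  have h5 : ((j i : ℕ) : ℝ) < (j' i : ℕ) + 1 := by linarith
  have h6 : ((j' i : ℕ) : ℝ) < (j i : ℕ) + 1 := by linarith
  norm_cast at h5 h6
  omega

theorem abs_bumpSum_le (m : ℕ) (S : Finset (Fin d → Fin m)) {ψ : (Fin d → ℝ) → ℝ}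
    (hψ : IsTestFunction ψ) {B : ℝ} (hB : ∀ y, |ψ y| ≤ B) (x : Fin d → ℝ) :
    |bumpSum m S ψ x| ≤ B := by
  by_cases h : ∃ j ∈ S, ψ ((m : ℝ) • x - corner j) ≠ 0
  · obtain ⟨j, hj, hne⟩ := h
    rw [bumpSum, Finset.sum_eq_single_of_mem j hj]
    · exact hB _
    · intro j' _ hj'
      by_contra h'
      exact hj' (eq_of_bump_ne_zero hψ h' hne)
  · push Not at h
    rw [bumpSum, Finset.sum_eq_zero h, abs_zero]
    exact (abs_nonneg _).trans (hB 0)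

theorem integral_bumpSum {m : ℕ} (hm : 0 < m) (S : Finset (Fin d → Fin m))
    {ψ : (Fin d → ℝ) → ℝ} (hψ : IsTestFunction ψ) :
    ∫ x, bumpSum m S ψ x ∂cubeMeasure d = S.card * ((m : ℝ) ^ d)⁻¹ * ∫ x, ψ x := by
  have hm' : (0 : ℝ) < m := by exact_mod_cast hm
  have hone : ∀ j : Fin d → Fin m,
      ∫ x, ψ ((m : ℝ) • x - corner j) ∂cubeMeasure d = ((m : ℝ) ^ d)⁻¹ * ∫ x, ψ x := by
    intro j
    rw [cubeMeasure, setIntegral_eq_integral_of_forall_compl_eq_zero]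
    · rw [Measure.integral_comp_smul volume (fun y => ψ (y - corner j)), integral_sub_right_eq_self]
      simp [abs_of_pos hm']
    · intro x hx
      by_contra h
      refine hx (Set.mem_Icc.2 ⟨fun i => ?_, fun i => ?_⟩)
      all_goals
        obtain ⟨h1, h2⟩ := hψ.mem_Ioo h i
        simp only [corner, Pi.sub_apply, Pi.smul_apply, smul_eq_mul] at h1 h2
        have h3 : ((j i : ℕ) : ℝ) + 1 ≤ m := by exact_mod_cast (j i).2
        have h4 : (0 : ℝ) ≤ (j i : ℕ) := by positivity
      · simp only [Pi.zero_apply]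
        by_contra hlt
        nlinarith
      · simp only [Pi.one_apply]
        by_contra hlt
        nlinarith
  have hint : ∀ j ∈ S, Integrable (fun x => ψ ((m : ℝ) • x - corner j)) (cubeMeasure d) := by
    intro j _
    have hc : Continuous fun x : Fin d → ℝ => ψ ((m : ℝ) • x - corner j) :=
      hψ.1.continuous.comp (by fun_prop)
    exact hc.continuousOn.integrableOn_compact isCompact_Icc
  simp only [bumpSum]
  rw [integral_finsetSum S hint]
  simp [hone, mul_assoc]

theorem exists_testFunction_pos : ∃ ψ : (Fin d → ℝ) → ℝ, IsTestFunction ψ ∧ 0 < ∫ x, ψ x := by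
  let b : ContDiffBump (fun _ : Fin d => (1 / 2 : ℝ)) := ⟨1 / 8, 1 / 4, by norm_num, by norm_num⟩
  refine ⟨b, ⟨b.contDiff, b.hasCompactSupport, ?_⟩, b.integral_pos⟩
  rw [b.tsupport_eq, interior_cube]
  intro x hx i _
  have h := (dist_le_pi_dist x _ i).trans (Metric.mem_closedBall.1 hx)
  rw [Real.dist_eq, abs_le] at h
  constructor <;> simp only [b] at h ⊢ <;> linarith [h.1, h.2]

/-- Each point lies in the support of at most one bump, so `X` spoils at most `X.card` bumps. -/
theorem card_filter_bump_eq_zero {m : ℕ} {ψ : (Fin d → ℝ) → ℝ} (hψ : IsTestFunction ψ)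
    (X : Finset (Fin d → ℝ)) [DecidablePred fun j : Fin d → Fin m =>
      ∀ x ∈ X, ψ ((m : ℝ) • x - corner j) = 0] :
    m ^ d ≤ (Finset.univ.filter fun j : Fin d → Fin m =>
      ∀ x ∈ X, ψ ((m : ℝ) • x - corner j) = 0).card + X.card := by
  have htot := Finset.card_filter_add_card_filter_not (s := Finset.univ)
    (fun j : Fin d → Fin m => ∀ x ∈ X, ψ ((m : ℝ) • x - corner j) = 0)
  have hle : (Finset.univ.filter fun j : Fin d → Fin m =>
      ¬ ∀ x ∈ X, ψ ((m : ℝ) • x - corner j) = 0).card ≤ X.card := by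
    refine Finset.card_le_card_of_forall_subsingleton
      (fun j x => ψ ((m : ℝ) • x - corner j) ≠ 0) ?_ ?_
    · intro j hj
      simpa using hj
    · intro x _ j hj j' hj'
      exact eq_of_bump_ne_zero hψ hj.2 hj'.2
  simp only [Finset.card_univ, Fintype.card_pi, Fintype.card_fin, Finset.prod_const] at htot
  omega

/-- With about `2M` cubes at least half of the bumps miss `X`. Their sum has integral of order one,
and scaling by `m ^ (-r)` offsets the growth of the derivatives. -/
theorem exists_fooling_function (hd : 1 ≤ d) (r : ℕ) {p : ℝ} (hp : 1 ≤ p) :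
    ∃ c : ℝ, 0 < c ∧ ∀ (M : ℕ) (X : Finset (Fin d → ℝ)), 1 ≤ M → X.card ≤ M →
      ∃ g : (Fin d → ℝ) → ℝ, ∃ F ∈ inputSet d r p, IsContRep F g ∧ (∀ x ∈ X, g x = 0) ∧
        c * (M : ℝ) ^ (-((r : ℝ) / d)) ≤ ∫ x, g x ∂cubeMeasure d := by
  classical
  obtain ⟨ψ, hψ, hI⟩ := exists_testFunction_pos (d := d)
  set I := ∫ x, ψ x with hIdef
  have hbdd : ∀ α : Fin d → ℕ, ∃ B : ℝ, ∀ y, |revDeriv α (List.finRange d) ψ y| ≤ B := fun α =>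
    (hψ.revDeriv α _).2.1.exists_bound_of_continuous (hψ.revDeriv α _).1.continuous
  choose B hB using hbdd
  have hB0 : ∀ α, 0 ≤ B α := fun α => (abs_nonneg _).trans (hB α 0)
  set C := 1 + ∑ α ∈ multiIndices d r, B α with hC
  have hC1 : 1 ≤ C := by
    have := Finset.sum_nonneg fun α (_ : α ∈ multiIndices d r) => hB0 α
    linarith
  have hBC : ∀ α ∈ multiIndices d r, B α ≤ C := fun α hα => by
    have := Finset.single_le_sum (fun α _ => hB0 α) hα
    linarith
  set b : ℝ := ((multiIndices d r).card + 1 : ℝ)⁻¹ with hbdef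
  have hb0 : 0 < b := by positivity
  have hb1 : (multiIndices d r).card * b ≤ 1 := by
    rw [hbdef, ← div_eq_mul_inv, div_le_one (by positivity)]
    linarith
  have hd0 : (0 : ℝ) < d := by exact_mod_cast hd
  -- The power comes from `m ≤ 2 * (2M) ^ (1/d)`, the factor `I / 2` from keeping at least half of
  -- the bumps.
  refine ⟨b / C * (2 * (2 : ℝ) ^ ((1 : ℝ) / d)) ^ (-(r : ℝ)) * (I / 2), by positivity, ?_⟩
  intro M X hM hX
  have hM0 : (0 : ℝ) < M := by exact_mod_cast hM
  set y : ℝ := (2 * M : ℝ) ^ ((1 : ℝ) / d) with hy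
  have hy1 : 1 ≤ y := Real.one_le_rpow (by
    have : (1 : ℝ) ≤ M := by exact_mod_cast hM
    linarith) (by positivity)
  set m := ⌈y⌉₊ with hmdef
  have hym : y ≤ m := Nat.le_ceil y
  have hm0 : (0 : ℝ) < m := by linarith
  have hm : 0 < m := by exact_mod_cast hm0
  have hm1 : (1 : ℝ) ≤ m := by linarith
  have hm2y : (m : ℝ) ≤ 2 * y := by
    have := Nat.ceil_lt_add_one (by linarith : 0 ≤ y)
    linarith
  have hmd : 2 * (M : ℝ) ≤ (m : ℝ) ^ d := by
    calc 2 * (M : ℝ) = y ^ d := by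
          rw [hy, ← Real.rpow_natCast, ← Real.rpow_mul (by positivity),
            one_div_mul_cancel hd0.ne', Real.rpow_one]
      _ ≤ (m : ℝ) ^ d := by gcongr
  set S := Finset.univ.filter fun j : Fin d → Fin m => ∀ x ∈ X, ψ ((m : ℝ) • x - corner j) = 0
  have hcard : m ^ d ≤ S.card + X.card := card_filter_bump_eq_zero hψ X
  have hSm : (m : ℝ) ^ d / 2 ≤ S.card := by
    have h1 : ((m : ℝ)) ^ d ≤ S.card + X.card := by exact_mod_cast hcard
    have h2 : (X.card : ℝ) ≤ M := by exact_mod_cast hX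
    linarith
  -- A derivative of order at most `r` gains at most `m ^ r`, and `C` dominates all derivatives of
  -- `ψ` involved.
  set a : ℝ := b / C * ((m : ℝ) ^ r)⁻¹ with ha
  have ha0 : 0 < a := by positivity
  have hbound : ∀ α ∈ multiIndices d r, ∀ x ∈ cube d,
      |revDeriv α (List.finRange d) (a • bumpSum m S ψ) x| ≤ b := by
    intro α hα x _
    rw [revDeriv_smul_bumpSum α _ a m S hψ.1, Pi.smul_apply, smul_eq_mul, abs_mul]
    have h1 : |bumpSum m S (revDeriv α (List.finRange d) ψ) x| ≤ C :=
      (abs_bumpSum_le m S (hψ.revDeriv α _) (hB α) x).trans (hBC α hα)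
    have hsum : ((List.finRange d).map α).sum ≤ r := by
      rw [← List.ofFn_eq_map, List.sum_ofFn]
      exact (Finset.mem_filter.1 hα).2
    have h2 : |a * (m : ℝ) ^ ((List.finRange d).map α).sum| ≤ b / C := by
      rw [abs_of_pos (by positivity)]
      calc a * (m : ℝ) ^ ((List.finRange d).map α).sum ≤ a * (m : ℝ) ^ r := by gcongr
        _ = b / C := by rw [ha]; field_simp
    calc _ ≤ b / C * C := by gcongr
      _ = b := by field_simp
  obtain ⟨F, hF, hrep⟩ := exists_mem_inputSet r hp ((contDiff_bumpSum m S hψ.1).const_smul a)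
    hb0.le hb1 hbound
  refine ⟨_, F, hF, hrep, ?_, ?_⟩
  · intro x hx
    have : bumpSum m S ψ x = 0 := Finset.sum_eq_zero fun j hj => (Finset.mem_filter.1 hj).2 x hx
    simp [this]
  · simp only [smul_eq_mul]
    rw [integral_const_mul, integral_bumpSum hm S hψ]
    have h1 : (1 / 2 : ℝ) ≤ S.card * ((m : ℝ) ^ d)⁻¹ := by
      rw [← div_eq_mul_inv, le_div_iff₀ (by positivity)]
      linarith
    have h2 : (2 * (2 : ℝ) ^ ((1 : ℝ) / d)) ^ (-(r : ℝ)) * (M : ℝ) ^ (-((r : ℝ) / d)) ≤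
        ((m : ℝ) ^ r)⁻¹ := by
      calc _ = (2 * y) ^ (-(r : ℝ)) := by
            rw [hy, Real.mul_rpow (by norm_num : (0 : ℝ) ≤ 2) hM0.le, ← mul_assoc,
              Real.mul_rpow (x := 2 * (2 : ℝ) ^ ((1 : ℝ) / d)) (by positivity) (by positivity),
              ← Real.rpow_mul hM0.le]
            congr 2
            ring
        _ ≤ (m : ℝ) ^ (-(r : ℝ)) :=
            Real.rpow_le_rpow_of_nonpos hm0 hm2y (by simp)
        _ = ((m : ℝ) ^ r)⁻¹ := by rw [Real.rpow_neg hm0.le, Real.rpow_natCast]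
    calc _ = b / C * ((2 * (2 : ℝ) ^ ((1 : ℝ) / d)) ^ (-(r : ℝ)) * (M : ℝ) ^ (-((r : ℝ) / d))) *
          (1 / 2 * I) := by ring
      _ ≤ b / C * ((m : ℝ) ^ r)⁻¹ * (S.card * ((m : ℝ) ^ d)⁻¹ * I) := by gcongr
      _ = _ := by rw [ha]

end Bumps

/-! ### The lower bound and its logarithmic form -/

/-- Lower bound for the error of algorithms with at most `n` information and `k` random queries. -/
theorem exists_lower_bound_error {d : ℕ} (hd : 1 ≤ d) (r : ℕ) {p : ℝ} (hp : 1 ≤ p)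
    {Ω K' : Type*} [MeasurableSpace Ω] [Finite K'] (R : AccessRestriction Ω K') :
    ∃ c : ℝ, 0 < c ∧ ∀ n k : ℕ, 1 ≤ n → 1 ≤ k →
      ∀ A ∈ algorithms (integrationProblem d r p hp) R n k,
        ENNReal.ofReal (c * ((4 * n * (2 * Nat.card K') ^ (4 * k) : ℕ) : ℝ) ^ (-((r : ℝ) / d))) ≤
          A.error := by
  classical
  have := Fintype.ofFinite K'
  have := R.isProb
  obtain ⟨c, hc, hfool⟩ := exists_fooling_function hd r hp
  refine ⟨c / 4, by positivity, fun n k hn hk A hA => ?_⟩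
  have hne : Nonempty K' := by
    obtain ⟨ω⟩ := R.prob.nonempty_of_neZero
    exact ⟨R.nonempty_access.some ω⟩
  have hK : 0 < Nat.card K' := Nat.card_pos
  have hk4 : NeZero (4 * k) := ⟨by omega⟩
  let f₀ : inputSet d r p := ⟨0, zero_mem_inputSet d r p hp⟩
  obtain ⟨g, hg⟩ := A.exists_probes f₀ (4 * n) (4 * k)
  have hpt : ∀ t, ∃ x : cube d, (fun f : inputSet d r p => pointEval x (f : LpCube d p)) = (g t).1 :=
    fun t => (g t).2
  choose x hx using hpt
  have hcard : (Finset.univ.image fun t => (x t : Fin d → ℝ)).card ≤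
      4 * n * (2 * Nat.card K') ^ (4 * k) := by
    refine Finset.card_image_le.trans ?_
    rw [Finset.card_univ, Fintype.card_prod, Fintype.card_fun, Fintype.card_fin, Fintype.card_fin,
      mul_pow, Nat.card_eq_fintype_card]
    have h1 : 4 * k + 1 ≤ 2 ^ (4 * k) := Nat.lt_two_pow_self
    -- As `n ≥ 1`, the left side is at most `4n (4k + 1)`.
    have h2 : 4 * n + 4 * k ≤ 4 * n * 2 ^ (4 * k) := by nlinarith
    calc _ ≤ Fintype.card K' ^ (4 * k) * (4 * n * 2 ^ (4 * k)) := by gcongr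
      _ = _ := by ring
  obtain ⟨φ, F, hF, hrep, hzero, hint⟩ := hfool _ _ (Nat.one_le_iff_ne_zero.2 (by positivity)) hcard
  have hrep0 : IsContRep (0 : LpCube d p) 0 := ⟨continuousOn_const, Lp.coeFn_zero _ _ _⟩
  have hagree : ∀ t, (g t).1 ⟨F, hF⟩ = (g t).1 f₀ := by
    intro t
    rw [← hx t]
    change pointEval (x t) F = pointEval (x t) 0
    rw [pointEval_eq hrep, pointEval_eq hrep0,
      hzero _ (Finset.mem_image_of_mem (fun t => (x t : Fin d → ℝ)) (Finset.mem_univ t)),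
      Pi.zero_apply]
  obtain ⟨hs, hs2⟩ := half_le_measure_card_le (by omega) (by omega) hA f₀
  have hle := enorm_sub_le_four_mul_error hA.1 hs hs2
    (fun ω hω => hg ⟨F, hF⟩ hagree ω hω.1 hω.2)
  have hS : (integrationProblem d r p hp).S ⟨F, hF⟩ = ∫ x, φ x ∂cubeMeasure d :=
    integral_congr_ae hrep.2
  have hS0 : (integrationProblem d r p hp).S f₀ = 0 := by
    change ∫ x, (0 : LpCube d p) x ∂cubeMeasure d = 0
    rw [integral_congr_ae hrep0.2]
    simp
  rw [hS, hS0, sub_zero] at hle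
  have h4 : ENNReal.ofReal (4 * (c / 4 * ((4 * n * (2 * Nat.card K') ^ (4 * k) : ℕ) : ℝ) ^
      (-((r : ℝ) / d)))) ≤ 4 * A.error := by
    refine le_trans ?_ hle
    rw [Real.enorm_eq_ofReal_abs]
    refine ENNReal.ofReal_le_ofReal (le_trans (le_of_eq ?_) (hint.trans (le_abs_self _)))
    ring
  rw [ENNReal.ofReal_mul (by norm_num)] at h4
  have h5 : ENNReal.ofReal 4 = 4 := by simp
  rw [h5] at h4
  exact (ENNReal.mul_le_mul_iff_right (by simp) (by simp)).1 h4

end RestrictedMC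

theorem corollary2 (d r : ℕ) (hd : 1 ≤ d) (hr : 1 ≤ r) (p : ℝ) (hp : 1 ≤ p)
    (hemb : RestrictedMC.EmbeddingCondition d r p)
    {Ω K' : Type*} [MeasurableSpace Ω] (R : RestrictedMC.AccessRestriction Ω K')
    (hR : R.IsFinite)
    (σ : ℝ) (hσ0 : 0 < σ) (hσ1 : σ ≤ 1 - 1 / min p 2) (c₀ : ℝ) (hc₀ : 0 < c₀) :
    ∃ c₁ : ℝ, 0 < c₁ ∧ ∃ c₂ : ℝ, ∀ n k : ℕ, 1 ≤ n → 1 ≤ k →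
      RestrictedMC.minError (RestrictedMC.integrationProblem d r p hp) R n k ≤
        ENNReal.ofReal (c₀ * (n : ℝ) ^ (-((r : ℝ) / d) - σ)) →
      c₁ * σ * Real.logb 2 n + c₂ ≤ (k : ℝ) := by
  have hfin : Finite K' := hR.1
  have := R.isProb
  have hne : Nonempty K' := by
    obtain ⟨ω⟩ := R.prob.nonempty_of_neZero
    exact ⟨R.nonempty_access.some ω⟩
  obtain ⟨c, hc, hlow⟩ := RestrictedMC.exists_lower_bound_error hd r hp R
  have hK : 0 < Nat.card K' := Nat.card_pos
  set q : ℝ := 2 * Nat.card K' with hq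
  have hq2 : 2 ≤ q := by
    rw [hq]
    exact_mod_cast (by omega : 2 ≤ 2 * Nat.card K')
  set s : ℝ := (r : ℝ) / d with hs
  have hs0 : 0 < s := by
    have h1 : (0 : ℝ) < r := by exact_mod_cast hr
    have h2 : (0 : ℝ) < d := by exact_mod_cast hd
    positivity
  set T : ℝ := s * (4 * Real.logb 2 q) with hT
  have hT0 : 0 < T := by
    have : 0 < Real.logb 2 q := Real.logb_pos (by norm_num) (by linarith)
    positivity
  -- `T` is the cost per random query in the logarithm of the lower bound; `c₂` collects the terms
  -- free of `n` and `k`.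
  refine ⟨1 / T, by positivity, (Real.logb 2 c - Real.logb 2 c₀ - s * Real.logb 2 4) / T, ?_⟩
  intro n k hn hk h
  have hn0 : (0 : ℝ) < n := by exact_mod_cast hn
  have hmin := (le_iInf₂ fun A hA => hlow n k hn hk A hA).trans h
  rw [ENNReal.ofReal_le_ofReal_iff (by positivity)] at hmin
  push_cast at hmin
  rw [← hq] at hmin
  have hlog := Real.logb_le_logb_of_le (b := 2) (by norm_num) (by positivity) hmin
  rw [Real.logb_mul hc.ne' (by positivity), Real.logb_mul hc₀.ne' (by positivity),
    Real.logb_rpow_eq_mul_logb_of_pos (by positivity),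
    Real.logb_rpow_eq_mul_logb_of_pos hn0, Real.logb_mul (by positivity) (by positivity),
    Real.logb_mul (by positivity) (by positivity), Real.logb_pow] at hlog
  push_cast at hlog
  -- The terms `s * logb 2 n` on the two sides cancel.
  have hfinal : σ * Real.logb 2 n + (Real.logb 2 c - Real.logb 2 c₀ - s * Real.logb 2 4) ≤
      k * T := by
    rw [hT]
    linarith
  calc _ = (σ * Real.logb 2 n + (Real.logb 2 c - Real.logb 2 c₀ - s * Real.logb 2 4)) / T := by
        ring
    _ ≤ k := (div_le_iff₀ hT0).2 hfinal
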